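/- Let $r,s\ge 3$ and $\ell\ge 1$ be integers, and let $D=D_{r,s,\ell}$ be the dumbbell graph, obtained from two vertex-disjoint cycles $C_r$ and $C_s$ (of lengths $r$ and $s$) by choosing one vertex on each cycle and joining the two chosen vertices by a path of length $\ell$; thus $D$ has $r+s+\ell-1$ vertices. Let $\Phi=(D,\varphi)$ be a complex unit gain graph on $D$: $\varphi$ assigns to each oriented edge $(u,v)$ of $D$ a complex number of modulus $1$ such that $\varphi(u,v)=\varphi(v,u)^{-1}$. Let $A(\Phi)$ be the Hermitian matrix indexed by the vertices of $D$ with $A(\Phi)_{uv}=\varphi(u,v)$ if $u$ and $v$ are adjacent and $A(\Phi)_{uv}=0$ otherwise, and let $P_\Phi(x)=\det(xI-A(\Phi))$. The gain of a cycle is the product of the gains of its oriented edges when it is traversed once; its real part does not depend on the starting vertex or the direction. Let $a$ and $b$ be the real parts of the gains of $C_r$ and $C_s$, respectively. For a finite simple graph $G$ on $n$ vertices let $m_G(x)=\sum_{j=0}^{\lfloor n/2\rfloor}(-1)^j m(G,j)\,x^{n-2j}$ be its matching polynomial, where $m(G,j)$ is the number of sets of $j$ edges of $G$ no two of which share an endpoint.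 Let $D-C_r$ and $D-C_s$ be the graphs obtained from $D$ by deleting all vertices of $C_r$, respectively of $C_s$, and let $P_{\ell-1}$ be the path on $\ell-1$ vertices (the empty graph, with $m_{P_0}=1$, if $\ell=1$). Then $$P_\Phi(x)=m_{D}(x)-2a\,m_{D-C_r}(x)-2b\,m_{D-C_s}(x)+4ab\,m_{P_{\ell-1}}(x).$$ -/

import Mathlib

open Polynomial

/-- A complex unit gain graph with underlying simple graph `G`: every oriented edge (dart) carries
a complex number of modulus one, and reversing the edge inverts the gain. -/
structure UnitGainGraph {V : Type*} (G : SimpleGraph V) where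
  gain : G.Dart → Circle
  gain_symm : ∀ d : G.Dart, gain d.symm = (gain d)⁻¹

namespace UnitGainGraph

variable {V : Type*} {G : SimpleGraph V}

open Classical in
/-- The Hermitian adjacency matrix of a complex unit gain graph. -/
noncomputable def adjMatrix (Φ : UnitGainGraph G) : Matrix V V ℂ :=
  Matrix.of fun u v => if h : G.Adj u v then (Φ.gain ⟨(u, v), h⟩ : ℂ) else 0

/-- The characteristic polynomial `det (x I - A(Φ))` of a complex unit gain graph. -/
noncomputable def charPoly [Fintype V] [DecidableEq V] (Φ : UnitGainGraph G) : ℂ[X] :=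
  Φ.adjMatrix.charpoly

end UnitGainGraph

theorem cycleGraph_adj_finRotate {n : ℕ} (hn : 3 ≤ n) (i : Fin n) :
    (SimpleGraph.cycleGraph n).Adj i (finRotate n i) := by
  obtain ⟨m, rfl⟩ : ∃ m, n = m + 2 := ⟨n - 2, by omega⟩
  rw [SimpleGraph.cycleGraph_adj, finRotate_apply]
  right
  simp

/-- The gain of a cycle of length `n` in `G`, the cycle being given as an (injective) copy
`c 0, c 1, ..., c (n - 1)` of `C_n` in `G`: the product of the gains of the oriented edges met when
going once around it, `φ(c 0, c 1) φ(c 1, c 2) ⋯ φ(c (n - 1), c 0)`. -/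
noncomputable def UnitGainGraph.cycleGain {V : Type*} {G : SimpleGraph V} (Φ : UnitGainGraph G)
    {n : ℕ} (hn : 3 ≤ n) (c : SimpleGraph.Copy (SimpleGraph.cycleGraph n) G) : Circle :=
  ∏ i : Fin n,
    Φ.gain ⟨(c i, c (finRotate n i)), c.toHom.map_adj (cycleGraph_adj_finRotate hn i)⟩

/-- A set of edges of `G` no two of which share an endpoint. -/
def IsEdgeMatching {V : Type*} (G : SimpleGraph V) (M : Finset (Sym2 V)) : Prop :=
  (∀ e ∈ M, e ∈ G.edgeSet) ∧ ∀ e ∈ M, ∀ f ∈ M, e ≠ f → ∀ v, ¬ (v ∈ e ∧ v ∈ f)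

/-- The number `m(G, j)` of `j`-matchings of `G`. -/
noncomputable def numMatchings {V : Type*} [Finite V] (G : SimpleGraph V) (j : ℕ) : ℕ :=
  Nat.card {M : Finset (Sym2 V) // IsEdgeMatching G M ∧ M.card = j}

/-- The matching polynomial `∑_{j = 0}^{⌊n/2⌋} (-1)^j m(G, j) x^{n - 2j}`, where `n` is the order
of `G`, viewed with complex coefficients. -/
noncomputable def matchingPoly {V : Type*} [Finite V] (G : SimpleGraph V) : ℂ[X] :=
  ∑ j ∈ Finset.range (Nat.card V / 2 + 1),
    C ((-1 : ℂ) ^ j * (numMatchings G j : ℂ)) * X ^ (Nat.card V - 2 * j)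

/-- The vertices of the dumbbell graph: those of `C_r`, those of `C_s`, and the `ℓ - 1` interior
vertices of the connecting path. -/
abbrev DumbbellVertex (r s ℓ : ℕ) : Type := Fin r ⊕ Fin s ⊕ Fin (ℓ - 1)

/-- Adjacency in the dumbbell graph whose path of length `ℓ ≥ 1` joins the vertex `p` of `C_r` to
the vertex `q` of `C_s`. The interior path vertices are `0, ..., ℓ - 2`, listed from `p` to `q`;
for `ℓ = 1` the path is the single edge `p q`. -/
def dumbbellAdj {r s ℓ : ℕ} (p : Fin r) (q : Fin s) :
    DumbbellVertex r s ℓ → DumbbellVertex r s ℓ → Prop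
  | .inl i, .inl i' => (SimpleGraph.cycleGraph r).Adj i i'
  | .inl i, .inr (.inl j) => ℓ = 1 ∧ i = p ∧ j = q
  | .inl i, .inr (.inr k) => i = p ∧ (k : ℕ) = 0
  | .inr (.inl j), .inl i => ℓ = 1 ∧ i = p ∧ j = q
  | .inr (.inl j), .inr (.inl j') => (SimpleGraph.cycleGraph s).Adj j j'
  | .inr (.inl j), .inr (.inr k) => j = q ∧ (k : ℕ) + 2 = ℓ
  | .inr (.inr k), .inl i => i = p ∧ (k : ℕ) = 0
  | .inr (.inr k), .inr (.inl j) => j = q ∧ (k : ℕ) + 2 = ℓ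
  | .inr (.inr k), .inr (.inr k') => (SimpleGraph.pathGraph (ℓ - 1)).Adj k k'

/-- The dumbbell graph `D_{r,s,ℓ}`: the disjoint cycles `C_r` and `C_s`, with the chosen vertices
`p` of `C_r` and `q` of `C_s` joined by a path of length `ℓ`. -/
def dumbbell (r s ℓ : ℕ) (p : Fin r) (q : Fin s) : SimpleGraph (DumbbellVertex r s ℓ) where
  Adj := dumbbellAdj p q
  symm := ⟨by
    rintro (i | j | k) (i' | j' | k') h
    · exact SimpleGraph.Adj.symm h
    · exact h
    · exact h
    · exact h
    · exact SimpleGraph.Adj.symm h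
    · exact h
    · exact h
    · exact h
    · exact SimpleGraph.Adj.symm h⟩
  loopless := ⟨by
    rintro (i | j | k) h
    · exact (SimpleGraph.cycleGraph r).irrefl h
    · exact (SimpleGraph.cycleGraph s).irrefl h
    · exact (SimpleGraph.pathGraph (ℓ - 1)).irrefl h⟩

/-- The cycle `C_r` of the dumbbell graph. -/
def dumbbellCycleLeft (r s ℓ : ℕ) (p : Fin r) (q : Fin s) :
    SimpleGraph.Copy (SimpleGraph.cycleGraph r) (dumbbell r s ℓ p q) where
  toHom := { toFun := fun i => Sum.inl i, map_rel' := fun h => h }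
  injective' := fun _ _ h => Sum.inl_injective h

/-- The cycle `C_s` of the dumbbell graph. -/
def dumbbellCycleRight (r s ℓ : ℕ) (p : Fin r) (q : Fin s) :
    SimpleGraph.Copy (SimpleGraph.cycleGraph s) (dumbbell r s ℓ p q) where
  toHom := { toFun := fun j => Sum.inr (Sum.inl j), map_rel' := fun h => h }
  injective' := fun _ _ h => Sum.inl_injective (Sum.inr_injective h)

/-- The graph `G - H` obtained by deleting from `G` the vertices of a copy of `H` in `G`. -/
abbrev deleteCopy {V W : Type*} (G : SimpleGraph V) {H : SimpleGraph W}
    (c : SimpleGraph.Copy H G) : SimpleGraph ↥((Set.range c)ᶜ : Set V) :=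
  G.induce (Set.range c)ᶜ

/-!
In the Leibniz expansion of `det (x I - A(Φ))` only the permutations that move vertices along edges
contribute. Such a permutation splits uniquely into its cycles of length at least three and an
involution of the vertices that these leave fixed. The edges exchanged by the involution carry the
product `φ(u, v) φ(v, u) = 1`, so, for given long cycles, the involutions add up to the matching
polynomial of the graph that remains after deleting them. Hence `P_Φ` is a sum over the families of
disjoint oriented cycles of length at least three. In the dumbbell every edge of the connecting path
is a bridge, which such a family cannot traverse, so the only cycles available are `C_r` and `C_s`,
each in two directions. Opposite directions have conjugate gains, and a rotation of the whole cycle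
enters with sign `-1` in total, which turns the two directions into the factors `-2a` and `-2b`.
-/

open Equiv (Perm)

section Matchings

variable {V W : Type*} {G : SimpleGraph V} {H : SimpleGraph W} {M : Finset (Sym2 V)}

namespace IsEdgeMatching

theorem eq_of_mk_mem (hM : IsEdgeMatching G M) {u v w : V} (hv : s(u, v) ∈ M)
    (hw : s(u, w) ∈ M) : v = w := by
  by_contra hne
  exact hM.2 _ hv _ hw (fun h => hne (Sym2.congr_right.1 h)) u
    ⟨Sym2.mem_mk_left _ _, Sym2.mem_mk_left _ _⟩

theorem two_mul_card_le [Finite V] (hM : IsEdgeMatching G M) : 2 * M.card ≤ Nat.card V := by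
  classical
  have := Fintype.ofFinite V
  have hdisj : (M : Set (Sym2 V)).PairwiseDisjoint Sym2.toFinset := fun e he f hf hne =>
    Finset.disjoint_left.2 fun v hve hvf =>
      hM.2 e he f hf hne v ⟨Sym2.mem_toFinset.1 hve, Sym2.mem_toFinset.1 hvf⟩
  calc 2 * M.card = ∑ e ∈ M, e.toFinset.card := by
        rw [Finset.sum_congr rfl fun e he =>
          Sym2.card_toFinset_of_not_isDiag e (G.not_isDiag_of_mem_edgeSet (hM.1 e he)),
          Finset.sum_const, smul_eq_mul, mul_comm]
    _ = (M.biUnion Sym2.toFinset).card := (Finset.card_biUnion hdisj).symm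
    _ ≤ Nat.card V := Nat.card_eq_fintype_card (α := V) ▸ Finset.card_le_univ _

theorem map_copy (hM : IsEdgeMatching G M) (c : SimpleGraph.Copy G H) :
    IsEdgeMatching H (M.map c.toEmbedding.sym2Map) := by
  simp only [IsEdgeMatching, Finset.forall_mem_map]
  refine ⟨fun e he => ?_, fun e he f hf hne w hw => ?_⟩
  · induction e with | _ u v => exact c.toHom.map_adj (hM.1 _ he)
  · obtain ⟨⟨u, hue, rfl⟩, ⟨v, hvf, hvu⟩⟩ := hw.imp Sym2.mem_map.1 Sym2.mem_map.1
    obtain rfl := c.injective hvu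
    exact hM.2 e he f hf (fun h => hne (h ▸ rfl)) v ⟨hue, hvf⟩

open Classical in
/-- The vertex matched with `v` by the set of edges `M`, and `v` itself if `M` does not cover `v`:
the involution that encodes a matching. -/
noncomputable def partner (M : Finset (Sym2 V)) (v : V) : V :=
  if h : ∃ u, s(v, u) ∈ M then h.choose else v

theorem mk_partner_mem {v : V} (hv : partner M v ≠ v) : s(v, partner M v) ∈ M := by
  unfold partner at hv ⊢
  split_ifs at hv ⊢ with h
  · exact h.choose_spec
  · exact absurd rfl hv

theorem partner_eq (hM : IsEdgeMatching G M) {u v : V} (h : s(u, v) ∈ M) : partner M u = v :=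
  have h' : ∃ v, s(u, v) ∈ M := ⟨v, h⟩
  hM.eq_of_mk_mem (by rw [partner, dif_pos h']; exact h'.choose_spec) h

theorem partner_involutive (hM : IsEdgeMatching G M) :
    Function.Involutive (partner M) := fun v => by
  by_cases hv : partner M v = v
  · rw [hv, hv]
  · exact hM.partner_eq (Sym2.eq_swap ▸ mk_partner_mem hv)

end IsEdgeMatching

theorem numMatchings_le_of_copy [Finite V] [Finite W] (c : SimpleGraph.Copy G H) (j : ℕ) :
    numMatchings G j ≤ numMatchings H j :=
  Nat.card_le_card_of_injective
    (fun M => ⟨M.1.map c.toEmbedding.sym2Map, M.2.1.map_copy c, by rw [Finset.card_map, M.2.2]⟩)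
    fun _ _ h => Subtype.ext (Finset.map_injective _ (congrArg Subtype.val h))

theorem matchingPoly_eq_of_iso [Finite V] [Finite W] (e : G ≃g H) :
    matchingPoly G = matchingPoly H := by
  have hnum : numMatchings G = numMatchings H := funext fun j =>
    le_antisymm (numMatchings_le_of_copy e.toCopy j) (numMatchings_le_of_copy e.symm.toCopy j)
  rw [matchingPoly, matchingPoly, hnum, Nat.card_congr e.toEquiv]

open Classical in
theorem matchingPoly_eq_sum_isEdgeMatching [Fintype V] (G : SimpleGraph V) :
    matchingPoly G = ∑ M : Finset (Sym2 V) with IsEdgeMatching G M,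
      C ((-1 : ℂ) ^ M.card) * X ^ (Fintype.card V - 2 * M.card) := by
  have hcard : ∀ M ∈ Finset.univ.filter (IsEdgeMatching G),
      M.card ∈ Finset.range (Nat.card V / 2 + 1) := fun M hM => by
    have := (Finset.mem_filter.1 hM).2.two_mul_card_le
    exact Finset.mem_range.2 (by omega)
  rw [matchingPoly, ← Finset.sum_fiberwise_of_maps_to hcard]
  refine Finset.sum_congr rfl fun j _ => ?_
  rw [Finset.sum_congr rfl fun M hM => by rw [(Finset.mem_filter.1 hM).2],
    Finset.sum_const, Finset.filter_filter, numMatchings, Nat.card_eq_fintype_card,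
    Nat.card_eq_fintype_card, Fintype.card_subtype, nsmul_eq_mul, C_mul, map_natCast]
  ring

end Matchings

section PermutationsAlongEdges

variable {V : Type*} {G : SimpleGraph V} {σ : Perm V}

/-- `σ` sends every vertex to itself or to a neighbour; these are the permutations that contribute
to the Leibniz expansion of a determinant supported on the edges of `G` and on the diagonal. -/
def MovesAlongEdges (G : SimpleGraph V) (σ : Perm V) : Prop :=
  ∀ v, σ v ≠ v → G.Adj v (σ v)

theorem MovesAlongEdges.inv (hσ : MovesAlongEdges G σ) : MovesAlongEdges G σ⁻¹ := fun v hv => by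
  simpa using (hσ (σ⁻¹ v) (by simpa using hv.symm)).symm

variable [Fintype V] [DecidableEq V]

/-- The set of two-element orbits `{v, σ v}` of an involution `σ`, as edges. -/
def swappedPairs (σ : Perm V) : Finset (Sym2 V) :=
  σ.support.image fun v => s(v, σ v)

theorem mk_mem_swappedPairs_iff (hσ : Function.Involutive σ) {u v : V} :
    s(u, v) ∈ swappedPairs σ ↔ σ u ≠ u ∧ σ u = v := by
  simp only [swappedPairs, Finset.mem_image, Equiv.Perm.mem_support, Sym2.eq_iff]
  constructor
  · rintro ⟨w, hw, ⟨rfl, rfl⟩ | ⟨rfl, rfl⟩⟩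
    · exact ⟨hw, rfl⟩
    · rw [hσ]
      exact ⟨hw.symm, rfl⟩
  · rintro ⟨h, rfl⟩
    exact ⟨u, h, Or.inl ⟨rfl, rfl⟩⟩

theorem swappedPairs_injOn :
    Set.InjOn (swappedPairs (V := V)) {σ : Perm V | Function.Involutive σ} := by
  intro σ hσ τ hτ h
  have hpair (v u : V) : (σ v ≠ v ∧ σ v = u) ↔ (τ v ≠ v ∧ τ v = u) := by
    rw [← mk_mem_swappedPairs_iff hσ, ← mk_mem_swappedPairs_iff hτ, h]
  ext v
  by_cases hv : σ v = v
  · by_contra hne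
    exact ((hpair v (τ v)).2 ⟨fun hτv => hne (hv.trans hτv.symm), rfl⟩).1 hv
  · exact ((hpair v (σ v)).1 ⟨hv, rfl⟩).2.symm

theorem isEdgeMatching_swappedPairs (hσ : Function.Involutive σ) (hG : MovesAlongEdges G σ) :
    IsEdgeMatching G (swappedPairs σ) := by
  constructor
  · rintro ⟨u, v⟩ h
    obtain ⟨hu, rfl⟩ := (mk_mem_swappedPairs_iff hσ).1 h
    exact hG u hu
  · intro e he f hf hne v ⟨hve, hvf⟩
    obtain ⟨u, rfl⟩ := Sym2.mem_iff_exists.1 hve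
    obtain ⟨w, rfl⟩ := Sym2.mem_iff_exists.1 hvf
    obtain ⟨-, rfl⟩ := (mk_mem_swappedPairs_iff hσ).1 he
    obtain ⟨-, rfl⟩ := (mk_mem_swappedPairs_iff hσ).1 hf
    exact hne rfl

theorem card_support_eq_two_mul_card_swappedPairs (hσ : Function.Involutive σ) :
    σ.support.card = 2 * (swappedPairs σ).card := by
  rw [Finset.card_eq_sum_card_image fun v => s(v, σ v), ← swappedPairs,
    Finset.sum_const_nat (m := 2), mul_comm]
  rintro ⟨u, v⟩ h
  obtain ⟨hu, rfl⟩ := (mk_mem_swappedPairs_iff hσ).1 h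
  have hfiber : σ.support.filter (fun w => s(w, σ w) = s(u, σ u)) = {u, σ u} := by
    ext w
    simp only [Finset.mem_filter, Equiv.Perm.mem_support, Sym2.eq_iff, Finset.mem_insert,
      Finset.mem_singleton]
    grind [Function.Involutive]
  rw [hfiber, Finset.card_pair hu.symm]

theorem exists_swappedPairs_eq {M : Finset (Sym2 V)} (hM : IsEdgeMatching G M) :
    ∃ σ : Perm V, Function.Involutive σ ∧ MovesAlongEdges G σ ∧ swappedPairs σ = M := by
  have hinv : Function.Involutive (hM.partner_involutive.toPerm _) := hM.partner_involutive
  refine ⟨_, hinv, fun v hv => hM.1 _ (IsEdgeMatching.mk_partner_mem hv), ?_⟩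
  ext e
  induction e with | _ u v
  rw [mk_mem_swappedPairs_iff hinv]
  constructor
  · rintro ⟨hu, rfl⟩
    exact IsEdgeMatching.mk_partner_mem hu
  · intro h
    obtain rfl := hM.partner_eq h
    exact ⟨(G.ne_of_adj (hM.1 _ h)).symm, rfl⟩

open Classical in
theorem matchingPoly_eq_sum_involutive (G : SimpleGraph V) :
    matchingPoly G = ∑ σ : Perm V with MovesAlongEdges G σ ∧ Function.Involutive σ,
      C ((-1 : ℂ) ^ (σ.support.card / 2)) * X ^ σ.supportᶜ.card := by
  rw [matchingPoly_eq_sum_isEdgeMatching]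
  symm
  refine Finset.sum_bij (fun σ _ => swappedPairs σ) (fun σ hσ => ?_) (fun σ hσ τ hτ h => ?_)
    (fun M hM => ?_) fun σ hσ => ?_
  · obtain ⟨hG, hσ⟩ := (Finset.mem_filter.1 hσ).2
    exact Finset.mem_filter.2 ⟨Finset.mem_univ _, isEdgeMatching_swappedPairs hσ hG⟩
  · exact swappedPairs_injOn (Finset.mem_filter.1 hσ).2.2 (Finset.mem_filter.1 hτ).2.2 h
  · obtain ⟨σ, hσ, hG, rfl⟩ := exists_swappedPairs_eq (Finset.mem_filter.1 hM).2
    exact ⟨σ, Finset.mem_filter.2 ⟨Finset.mem_univ _, hG, hσ⟩, rfl⟩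
  · have hσ := (Finset.mem_filter.1 hσ).2.2
    rw [Finset.card_compl, card_support_eq_two_mul_card_swappedPairs hσ,
      Nat.mul_div_cancel_left _ two_pos]

end PermutationsAlongEdges

section LongCyclePart

variable {V : Type*} {G : SimpleGraph V} {σ π : Perm V}

/-- No orbit of `π` has exactly two elements: `π` has fixed points and cycles of length at least
three only. -/
def HasNoTwoCycles (π : Perm V) : Prop :=
  ∀ v, π (π v) = v → π v = v

/-- `π` rotates the members of a family of vertex-disjoint cycles of `G`, each in one of its two
directions, and fixes all other vertices. -/
structure IsCycleSystem (G : SimpleGraph V) (π : Perm V) : Prop where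
  movesAlongEdges : MovesAlongEdges G π
  hasNoTwoCycles : HasNoTwoCycles π

/-- The permutation obtained from `σ` by removing its cycles of length two. -/
def longCyclePart [DecidableEq V] (σ : Perm V) : Perm V where
  toFun v := if σ (σ v) = v then v else σ v
  invFun v := if σ.symm (σ.symm v) = v then v else σ.symm v
  left_inv v := by grind
  right_inv v := by grind

theorem longCyclePart_apply [DecidableEq V] (v : V) :
    longCyclePart σ v = if σ (σ v) = v then v else σ v := rfl

theorem longCyclePart_eq_iff [DecidableEq V] (hπ : HasNoTwoCycles π) :
    longCyclePart σ = π ↔ (∀ v, π v ≠ v → σ v = π v) ∧ ∀ v, π v = v → σ (σ v) = v := by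
  constructor
  · rintro rfl
    refine ⟨fun v hv => ?_, fun v hv => ?_⟩
    · rw [longCyclePart_apply] at hv ⊢
      split_ifs at hv ⊢ with h
      · exact absurd rfl hv
      · rfl
    · by_contra hne
      rw [longCyclePart_apply, if_neg hne] at hv
      exact hne (by rw [hv, hv])
  · rintro ⟨hmove, hfix⟩
    ext v
    rw [longCyclePart_apply]
    by_cases hv : π v = v
    · rw [if_pos (hfix v hv), hv]
    · have hv' : π (π v) ≠ v := fun h => hv (hπ v h)
      rw [hmove v hv, hmove (π v) fun h => hv (π.injective h), if_neg hv']

theorem hasNoTwoCycles_longCyclePart [DecidableEq V] (σ : Perm V) :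
    HasNoTwoCycles (longCyclePart σ) := fun v => by
  grind [longCyclePart_apply]

theorem MovesAlongEdges.isCycleSystem_longCyclePart [DecidableEq V] (hσ : MovesAlongEdges G σ) :
    IsCycleSystem G (longCyclePart σ) where
  movesAlongEdges v hv := by
    rw [longCyclePart_apply] at hv ⊢
    split_ifs at hv ⊢ with h
    · exact absurd rfl hv
    · exact hσ v hv
  hasNoTwoCycles := hasNoTwoCycles_longCyclePart σ

end LongCyclePart

section FixedPoints

variable {V : Type*} {G : SimpleGraph V} {π : Perm V}

theorem movesAlongEdges_mul_iff {σ τ : Perm V} (h : σ.Disjoint τ) :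
    MovesAlongEdges G (σ * τ) ↔ MovesAlongEdges G σ ∧ MovesAlongEdges G τ := by
  have hσ {v : V} (hv : τ v = v) : (σ * τ) v = σ v := by rw [Perm.mul_apply, hv]
  have hτ {v : V} (hv : σ v = v) : (σ * τ) v = τ v := by rw [h.commute.eq, Perm.mul_apply, hv]
  refine ⟨fun hG => ⟨fun v hv => ?_, fun v hv => ?_⟩, fun hG v hv => ?_⟩
  · have hfix := (h v).resolve_left hv
    rw [← hσ hfix] at hv ⊢
    exact hG v hv
  · have hfix := (h v).resolve_right hv
    rw [← hτ hfix] at hv ⊢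
    exact hG v hv
  · rcases h v with hfix | hfix
    · rw [hτ hfix] at hv ⊢
      exact hG.2 v hv
    · rw [hσ hfix] at hv ⊢
      exact hG.1 v hv

theorem movesAlongEdges_ofSubtype_iff {s : Set V} [DecidablePred (· ∈ s)] {τ : Perm s} :
    MovesAlongEdges G (Perm.ofSubtype τ) ↔ MovesAlongEdges (G.induce s) τ := by
  refine ⟨fun h v hv => ?_, fun h v hv => ?_⟩
  · have := h v
    rw [Perm.ofSubtype_apply_coe] at this
    exact this fun h => hv (Subtype.ext h)
  · by_cases hvs : v ∈ s
    · lift v to s using hvs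
      rw [Perm.ofSubtype_apply_coe] at hv ⊢
      exact h v fun h => hv (congrArg _ h)
    · exact absurd (Perm.ofSubtype_apply_of_not_mem τ hvs) hv

variable [DecidableEq V]

theorem disjoint_ofSubtype_fixedPoints (π : Perm V) (τ : Perm (Function.fixedPoints π)) :
    π.Disjoint (Perm.ofSubtype τ) := fun v => by
  by_cases hv : π v = v
  · exact .inl hv
  · exact .inr (Perm.ofSubtype_apply_of_not_mem τ hv)

theorem mul_ofSubtype_apply_coe (π : Perm V) (τ : Perm (Function.fixedPoints π))
    (v : Function.fixedPoints π) : (π * Perm.ofSubtype τ) v = τ v := by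
  rw [Perm.mul_apply, Perm.ofSubtype_apply_coe]
  exact (τ v).2

theorem mul_ofSubtype_apply_of_ne (τ : Perm (Function.fixedPoints π)) {v : V} (hv : π v ≠ v) :
    (π * Perm.ofSubtype τ) v = π v := by
  rw [Perm.mul_apply, Perm.ofSubtype_apply_of_not_mem τ hv]

theorem HasNoTwoCycles.longCyclePart_mul_ofSubtype_eq_iff (hπ : HasNoTwoCycles π)
    {τ : Perm (Function.fixedPoints π)} :
    longCyclePart (π * Perm.ofSubtype τ) = π ↔ Function.Involutive τ := by
  rw [longCyclePart_eq_iff hπ, and_iff_right fun v => mul_ofSubtype_apply_of_ne τ]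
  refine ⟨fun h v => Subtype.ext ?_, fun h v hv => ?_⟩
  · simpa only [mul_ofSubtype_apply_coe] using h v v.2
  · lift v to Function.fixedPoints π using hv
    rw [mul_ofSubtype_apply_coe, mul_ofSubtype_apply_coe, h]

theorem HasNoTwoCycles.exists_mul_ofSubtype_eq (hπ : HasNoTwoCycles π) {σ : Perm V}
    (hσ : longCyclePart σ = π) :
    ∃ τ : Perm (Function.fixedPoints π), π * Perm.ofSubtype τ = σ := by
  obtain ⟨hmove, -⟩ := (longCyclePart_eq_iff hπ).1 hσ
  have hfix {v : V} (hv : (π⁻¹ * σ) v ≠ v) : v ∈ Function.fixedPoints π := by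
    by_contra hne
    exact hv (by rw [Perm.mul_apply, hmove v hne]; exact π.symm_apply_apply v)
  have hmaps (v : V) : (π⁻¹ * σ) v ∈ Function.fixedPoints π ↔ v ∈ Function.fixedPoints π := by
    by_cases hv : (π⁻¹ * σ) v = v
    · rw [hv]
    · exact iff_of_true (hfix fun h => hv ((π⁻¹ * σ).injective h)) (hfix hv)
  refine ⟨(π⁻¹ * σ).subtypePerm hmaps, ?_⟩
  rw [Perm.ofSubtype_subtypePerm _ fun v => hfix, mul_inv_cancel_left]

theorem card_compl_support_mul_ofSubtype [Fintype V] (π : Perm V)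
    (τ : Perm (Function.fixedPoints π)) :
    (π * Perm.ofSubtype τ).supportᶜ.card = τ.supportᶜ.card := by
  rw [Finset.card_compl, Finset.card_compl, (disjoint_ofSubtype_fixedPoints π τ).card_support_mul,
    Perm.support_ofSubtype, Finset.card_map, Nat.sub_add_eq,
    Perm.card_fixedPoints, Perm.sum_cycleType]

end FixedPoints

namespace UnitGainGraph

variable {V : Type*} {G : SimpleGraph V} (Φ : UnitGainGraph G)

theorem adjMatrix_apply_of_adj {u v : V} (h : G.Adj u v) :
    Φ.adjMatrix u v = Φ.gain ⟨(u, v), h⟩ := by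
  simp [adjMatrix, h]

theorem adjMatrix_apply_of_not_adj {u v : V} (h : ¬ G.Adj u v) : Φ.adjMatrix u v = 0 := by
  simp [adjMatrix, h]

theorem isHermitian_adjMatrix : Φ.adjMatrix.IsHermitian := Matrix.IsHermitian.ext fun u v => by
  by_cases h : G.Adj u v
  · rw [Φ.adjMatrix_apply_of_adj h, Φ.adjMatrix_apply_of_adj h.symm, Complex.star_def,
      ← Circle.coe_inv_eq_conj, ← Φ.gain_symm]
    rfl
  · rw [Φ.adjMatrix_apply_of_not_adj h, Φ.adjMatrix_apply_of_not_adj fun h' => h h'.symm, star_zero]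

theorem adjMatrix_mul_adjMatrix_symm {u v : V} (h : G.Adj u v) :
    Φ.adjMatrix u v * Φ.adjMatrix v u = 1 := by
  rw [← Φ.isHermitian_adjMatrix.apply v u, Φ.adjMatrix_apply_of_adj h, Complex.star_def,
    ← Circle.coe_inv_eq_conj, ← Circle.coe_mul, mul_inv_cancel, Circle.coe_one]

variable [Fintype V] [DecidableEq V] {σ τ : Perm V}

/-- The coefficient with which the permutation `σ` enters the Leibniz expansion of
`det (x I - A(Φ))`, the diagonal entries `x` at the fixed points of `σ` being left out. -/
noncomputable def permWeight (σ : Perm V) : ℂ :=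
  Perm.sign σ * ∏ v ∈ σ.support, -Φ.adjMatrix v (σ v)

theorem charPoly_eq_sum_permWeight :
    Φ.charPoly = ∑ σ : Perm V, C (Φ.permWeight σ) * X ^ σ.supportᶜ.card := by
  rw [charPoly, Matrix.charpoly, ← Matrix.det_transpose, Matrix.det_apply']
  refine Finset.sum_congr rfl fun σ _ => ?_
  have hmoved : ∀ v ∈ σ.support,
      Φ.adjMatrix.charmatrix.transpose (σ v) v = C (-Φ.adjMatrix v (σ v)) := fun v hv => by
    rw [Matrix.transpose_apply, Matrix.charmatrix_apply_ne _ _ _ (Perm.mem_support.1 hv).symm,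
      C_neg]
  have hfixed : ∀ v ∈ σ.supportᶜ, Φ.adjMatrix.charmatrix.transpose (σ v) v = X := fun v hv => by
    rw [Matrix.transpose_apply, Perm.notMem_support.1 (Finset.mem_compl.1 hv),
      Matrix.charmatrix_apply_eq, Φ.adjMatrix_apply_of_not_adj (G.irrefl), C_0, sub_zero]
  rw [← Finset.prod_mul_prod_compl σ.support, Finset.prod_congr rfl hmoved,
    Finset.prod_congr rfl hfixed, Finset.prod_const, permWeight, C_mul, map_prod, mul_assoc,
    map_intCast]

theorem permWeight_one : Φ.permWeight 1 = 1 := by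
  simp [permWeight]

theorem movesAlongEdges_of_permWeight_ne_zero (h : Φ.permWeight σ ≠ 0) : MovesAlongEdges G σ := by
  intro v hv
  by_contra hadj
  refine h (mul_eq_zero_of_right _ (Finset.prod_eq_zero (Perm.mem_support.2 hv) ?_))
  rw [Φ.adjMatrix_apply_of_not_adj hadj, neg_zero]

theorem permWeight_inv (σ : Perm V) : Φ.permWeight σ⁻¹ = starRingEnd ℂ (Φ.permWeight σ) := by
  have hprod : ∏ v ∈ σ.support, -Φ.adjMatrix v (σ⁻¹ v) =
      ∏ v ∈ σ.support, -Φ.adjMatrix (σ v) v := by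
    refine (Finset.prod_equiv σ (fun v => Perm.apply_mem_support.symm) fun v _ => ?_).symm
    rw [Perm.inv_def, Equiv.symm_apply_apply]
  simp only [permWeight, Perm.sign_inv, Perm.support_inv, hprod, map_mul, map_intCast, map_prod,
    map_neg, starRingEnd_apply, Φ.isHermitian_adjMatrix.apply]

theorem permWeight_mul_of_disjoint (h : σ.Disjoint τ) :
    Φ.permWeight (σ * τ) = Φ.permWeight σ * Φ.permWeight τ := by
  have hσ : ∀ v ∈ σ.support, -Φ.adjMatrix v ((σ * τ) v) = -Φ.adjMatrix v (σ v) := fun v hv => by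
    rw [Perm.mul_apply, (h v).resolve_left (Perm.mem_support.1 hv)]
  have hτ : ∀ v ∈ τ.support, -Φ.adjMatrix v ((σ * τ) v) = -Φ.adjMatrix v (τ v) := fun v hv => by
    rw [h.commute.eq, Perm.mul_apply, (h v).resolve_right (Perm.mem_support.1 hv)]
  rw [permWeight, h.support_mul, Finset.prod_union h.disjoint_support, Finset.prod_congr rfl hσ,
    Finset.prod_congr rfl hτ, Perm.sign_mul, Units.val_mul, Int.cast_mul, mul_mul_mul_comm,
    permWeight, permWeight]

theorem permWeight_of_involutive (hσ : Function.Involutive σ) (hG : MovesAlongEdges G σ) :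
    Φ.permWeight σ = (-1) ^ (σ.support.card / 2) := by
  have hprod : ∏ v ∈ σ.support, -Φ.adjMatrix v (σ v) = 1 := by
    refine Finset.prod_involution (fun v _ => σ v) (fun v hv => ?_)
      (fun v hv _ => Perm.mem_support.1 hv) (fun v hv => Perm.apply_mem_support.2 hv)
      fun v _ => hσ v
    rw [hσ, neg_mul_neg, Φ.adjMatrix_mul_adjMatrix_symm (hG v (Perm.mem_support.1 hv))]
  have hsq : σ ^ 2 = 1 := Equiv.ext fun v => by rw [sq]; exact hσ v
  rw [permWeight, hprod, mul_one, Perm.sign_of_pow_two_eq_one hsq, Perm.card_fixedPoints,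
    Perm.sum_cycleType, Nat.sub_sub_self (Finset.card_le_univ _)]
  push_cast
  rfl

theorem permWeight_ofSubtype_of_involutive {s : Set V} [DecidablePred (· ∈ s)] {τ : Perm s}
    (hτ : Function.Involutive τ) (hG : MovesAlongEdges (G.induce s) τ) :
    Φ.permWeight (Perm.ofSubtype τ) = (-1) ^ (τ.support.card / 2) := by
  have hinv : Function.Involutive (Perm.ofSubtype τ) := fun v => by
    rw [← Perm.mul_apply, ← map_mul, show τ * τ = 1 from Equiv.ext hτ, map_one, Perm.one_apply]
  rw [Φ.permWeight_of_involutive hinv (movesAlongEdges_ofSubtype_iff.2 hG), Perm.support_ofSubtype,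
    Finset.card_map]

open Classical in
theorem sum_permWeight_longCyclePart_eq {π : Perm V} (hπ : IsCycleSystem G π) :
    ∑ σ : Perm V with MovesAlongEdges G σ ∧ longCyclePart σ = π,
        C (Φ.permWeight σ) * X ^ σ.supportᶜ.card =
      C (Φ.permWeight π) * matchingPoly (G.induce (Function.fixedPoints π)) := by
  have hdisj := disjoint_ofSubtype_fixedPoints π
  rw [matchingPoly_eq_sum_involutive, Finset.mul_sum]
  symm
  refine Finset.sum_bij (fun τ _ => π * Perm.ofSubtype τ) (fun τ hτ => ?_)
    (fun τ _ τ' _ h => Perm.ofSubtype_injective (mul_left_cancel h)) (fun σ hσ => ?_)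
    fun τ hτ => ?_
  · obtain ⟨-, hG, hinv⟩ := Finset.mem_filter.1 hτ
    exact Finset.mem_filter.2 ⟨Finset.mem_univ _,
      (movesAlongEdges_mul_iff (hdisj τ)).2
        ⟨hπ.movesAlongEdges, movesAlongEdges_ofSubtype_iff.2 hG⟩,
      hπ.hasNoTwoCycles.longCyclePart_mul_ofSubtype_eq_iff.2 hinv⟩
  · obtain ⟨-, hG, hσπ⟩ := Finset.mem_filter.1 hσ
    obtain ⟨τ, rfl⟩ := hπ.hasNoTwoCycles.exists_mul_ofSubtype_eq hσπ
    exact ⟨τ, Finset.mem_filter.2 ⟨Finset.mem_univ _,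
      movesAlongEdges_ofSubtype_iff.1 ((movesAlongEdges_mul_iff (hdisj τ)).1 hG).2,
      hπ.hasNoTwoCycles.longCyclePart_mul_ofSubtype_eq_iff.1 hσπ⟩, rfl⟩
  · obtain ⟨-, hG, hinv⟩ := Finset.mem_filter.1 hτ
    rw [Φ.permWeight_mul_of_disjoint (hdisj τ), Φ.permWeight_ofSubtype_of_involutive hinv hG,
      card_compl_support_mul_ofSubtype, C_mul, mul_assoc]

open Classical in
theorem charPoly_eq_sum_isCycleSystem :
    Φ.charPoly = ∑ π : Perm V with IsCycleSystem G π,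
      C (Φ.permWeight π) * matchingPoly (G.induce (Function.fixedPoints π)) := by
  have hmaps : ∀ σ ∈ Finset.univ.filter (MovesAlongEdges G),
      longCyclePart σ ∈ Finset.univ.filter (IsCycleSystem G) := fun σ hσ =>
    Finset.mem_filter.2 ⟨Finset.mem_univ _, (Finset.mem_filter.1 hσ).2.isCycleSystem_longCyclePart⟩
  rw [Φ.charPoly_eq_sum_permWeight, ← Finset.sum_filter_of_ne fun σ _ h =>
    Φ.movesAlongEdges_of_permWeight_ne_zero (C_ne_zero.1 (left_ne_zero_of_mul h)),
    ← Finset.sum_fiberwise_of_maps_to hmaps]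
  refine Finset.sum_congr rfl fun π hπ => ?_
  rw [Finset.filter_filter, Φ.sum_permWeight_longCyclePart_eq (Finset.mem_filter.1 hπ).2]

end UnitGainGraph

section Rotations

variable {V : Type*} {G : SimpleGraph V} {σ τ π : Perm V} {n : ℕ}

theorem finRotate_ne_self (hn : 2 ≤ n) (i : Fin n) : finRotate n i ≠ i :=
  Perm.mem_support.1 (support_finRotate_of_le hn ▸ Finset.mem_univ i)

theorem finRotate_finRotate_ne_self (hn : 3 ≤ n) (i : Fin n) :
    finRotate n (finRotate n i) ≠ i := by
  obtain ⟨m, rfl⟩ : ∃ m, n = m + 3 := ⟨n - 3, by omega⟩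
  simp [finRotate_apply, add_assoc, Fin.ext_iff, Fin.val_add, Nat.mod_eq_of_lt]

theorem sameCycle_finRotate (i j : Fin n) : (finRotate n).SameCycle i j := by
  rcases lt_or_ge n 2 with hn | hn
  · obtain rfl : i = j := by omega
    exact Perm.SameCycle.refl _ _
  · exact (isCycle_finRotate_of_le hn).sameCycle (finRotate_ne_self hn i) (finRotate_ne_self hn j)

theorem eq_finRotate_or_of_cycleGraph_adj {i j : Fin n} (h : (SimpleGraph.cycleGraph n).Adj i j) :
    j = finRotate n i ∨ j = (finRotate n)⁻¹ i := by
  match n with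
  | 0 => exact i.elim0
  | 1 => exact absurd (Subsingleton.elim i j) h.ne
  | m + 2 =>
    rw [SimpleGraph.cycleGraph_adj] at h
    rw [Perm.inv_def, Equiv.eq_symm_apply, finRotate_apply, finRotate_apply]
    rcases h with h | h
    · exact .inr (by rw [← h]; abel)
    · exact .inl (by rw [← h]; abel)

theorem HasNoTwoCycles.inv (hπ : HasNoTwoCycles π) : HasNoTwoCycles π⁻¹ := fun v hv => by
  rw [Perm.inv_eq_iff_eq, Perm.inv_eq_iff_eq] at hv
  rw [Perm.inv_eq_iff_eq]
  exact (hπ v hv.symm).symm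

theorem IsCycleSystem.inv (hπ : IsCycleSystem G π) : IsCycleSystem G π⁻¹ :=
  ⟨hπ.movesAlongEdges.inv, hπ.hasNoTwoCycles.inv⟩

theorem isCycleSystem_one (G : SimpleGraph V) : IsCycleSystem G 1 :=
  ⟨fun _ h => absurd rfl h, fun _ h => h⟩

theorem IsCycleSystem.mul_of_disjoint (hσ : IsCycleSystem G σ) (hτ : IsCycleSystem G τ)
    (h : σ.Disjoint τ) : IsCycleSystem G (σ * τ) where
  movesAlongEdges := (movesAlongEdges_mul_iff h).2 ⟨hσ.movesAlongEdges, hτ.movesAlongEdges⟩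
  hasNoTwoCycles v hv := by
    rcases h v with hfix | hfix
    · rw [h.commute.eq, ← Perm.mul_apply, h.commute.mul_mul_mul_comm] at hv
      rw [h.commute.eq, Perm.mul_apply, hfix]
      simp only [Perm.mul_apply, hfix] at hv
      exact hτ.hasNoTwoCycles v hv
    · rw [← Perm.mul_apply, h.commute.symm.mul_mul_mul_comm] at hv
      rw [Perm.mul_apply, hfix]
      simp only [Perm.mul_apply, hfix] at hv
      exact hσ.hasNoTwoCycles v hv

theorem HasNoTwoCycles.apply_eq_rotation {W : Type*} [Finite W] {c : W → V}
    (hc : Function.Injective c) {ρ : Perm W} (hρ : ∀ i, ρ i ≠ i) (hcycle : ∀ i j, ρ.SameCycle i j)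
    (hπ : HasNoTwoCycles π)
    (hstep : ∀ i, π (c i) = c i ∨ π (c i) = c (ρ i) ∨ π (c i) = c (ρ⁻¹ i)) {i : W}
    (hi : π (c i) = c (ρ i)) (j : W) : π (c j) = c (ρ j) := by
  have hnext {j : W} (hj : π (c j) = c (ρ j)) : π (c (ρ j)) = c (ρ (ρ j)) := by
    rcases hstep (ρ j) with h | h | h
    · exact absurd (hc (π.injective (h.trans hj.symm))) (hρ j)
    · exact h
    · rw [Perm.inv_def, Equiv.symm_apply_apply, ← hj] at h
      exact absurd (hc (hj.symm.trans (hπ _ h))) (hρ j)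
  obtain ⟨k, rfl⟩ := (hcycle i j).exists_nat_pow_eq
  induction k with
  | zero => exact hi
  | succ k ih =>
    rw [pow_succ', Perm.mul_apply]
    exact hnext ih

end Rotations

section CopyRotation

variable {V : Type*} [DecidableEq V] {G : SimpleGraph V} {n : ℕ}

/-- The permutation of `V` that moves every vertex of the cycle `c` of `G` to the next one and
fixes the vertices off the cycle. -/
def copyRotation (c : SimpleGraph.Copy (SimpleGraph.cycleGraph n) G) : Perm V :=
  (finRotate n).viaFintypeEmbedding c.toEmbedding

variable (c : SimpleGraph.Copy (SimpleGraph.cycleGraph n) G)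

theorem copyRotation_apply (i : Fin n) : copyRotation c (c i) = c (finRotate n i) :=
  Perm.viaFintypeEmbedding_apply_image _ c.toEmbedding i

theorem copyRotation_inv_apply (i : Fin n) : (copyRotation c)⁻¹ (c i) = c ((finRotate n)⁻¹ i) := by
  rw [Perm.inv_eq_iff_eq, copyRotation_apply, Perm.inv_def, Equiv.apply_symm_apply]

theorem copyRotation_apply_of_notMem_range {v : V} (hv : v ∉ Set.range c) :
    copyRotation c v = v :=
  Perm.viaFintypeEmbedding_apply_notMem_range _ c.toEmbedding hv

theorem copyRotation_apply_ne_iff (hn : 2 ≤ n) {v : V} :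
    copyRotation c v ≠ v ↔ v ∈ Set.range c := by
  refine ⟨fun h => by_contra fun hv => h (copyRotation_apply_of_notMem_range c hv), ?_⟩
  rintro ⟨i, rfl⟩
  rw [copyRotation_apply]
  exact fun h => finRotate_ne_self hn i (c.injective h)

theorem fixedPoints_copyRotation (hn : 2 ≤ n) :
    Function.fixedPoints (copyRotation c) = (Set.range c)ᶜ :=
  Set.ext fun _ => (not_iff_comm.1 (copyRotation_apply_ne_iff c hn)).symm

theorem isCycleSystem_copyRotation (hn : 3 ≤ n) : IsCycleSystem G (copyRotation c) where
  movesAlongEdges v hv := by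
    obtain ⟨i, rfl⟩ := (copyRotation_apply_ne_iff c (Nat.le_of_succ_le hn)).1 hv
    rw [copyRotation_apply]
    exact c.toHom.map_adj (cycleGraph_adj_finRotate hn i)
  hasNoTwoCycles v hv := by
    by_contra hne
    obtain ⟨i, rfl⟩ := (copyRotation_apply_ne_iff c (Nat.le_of_succ_le hn)).1 hne
    rw [copyRotation_apply, copyRotation_apply] at hv
    exact finRotate_finRotate_ne_self hn i (c.injective hv)

variable {c} {f : Perm V}

theorem copyRotation_ne_one (hn : 2 ≤ n) : copyRotation c ≠ 1 := fun h =>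
  (copyRotation_apply_ne_iff c hn).2 ⟨⟨0, by omega⟩, rfl⟩ (by rw [h, Perm.one_apply])

theorem copyRotation_ne_inv (hn : 3 ≤ n) : copyRotation c ≠ (copyRotation c)⁻¹ := fun h =>
  copyRotation_ne_one (Nat.le_of_succ_le hn) <| Equiv.ext fun v =>
    (isCycleSystem_copyRotation c hn).hasNoTwoCycles v (by rw [← Perm.eq_inv_iff_eq, ← h])

variable [Fintype V]

/-- The three ways in which a cycle system can act on the cycle `c`: not at all, or as a rotation
in one of the two directions. -/
def cycleTurns (c : SimpleGraph.Copy (SimpleGraph.cycleGraph n) G) : Finset (Perm V) :=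
  {1, copyRotation c, (copyRotation c)⁻¹}

theorem mem_cycleTurns :
    f ∈ cycleTurns c ↔ f = 1 ∨ f = copyRotation c ∨ f = (copyRotation c)⁻¹ := by
  simp only [cycleTurns, Finset.mem_insert, Finset.mem_singleton]

theorem isCycleSystem_of_mem_cycleTurns (hn : 3 ≤ n) (hf : f ∈ cycleTurns c) :
    IsCycleSystem G f := by
  rcases mem_cycleTurns.1 hf with rfl | rfl | rfl
  · exact isCycleSystem_one G
  · exact isCycleSystem_copyRotation c hn
  · exact (isCycleSystem_copyRotation c hn).inv

theorem apply_eq_self_of_mem_cycleTurns (hf : f ∈ cycleTurns c) {v : V} (hv : v ∉ Set.range c) :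
    f v = v := by
  rcases mem_cycleTurns.1 hf with rfl | rfl | rfl
  · rfl
  · exact copyRotation_apply_of_notMem_range c hv
  · rw [Perm.inv_eq_iff_eq, copyRotation_apply_of_notMem_range c hv]

theorem IsCycleSystem.exists_mem_cycleTurns_eqOn (hn : 3 ≤ n)
    (hc : ∀ i j, G.Adj (c i) (c j) → (SimpleGraph.cycleGraph n).Adj i j) {π : Perm V}
    (hπ : IsCycleSystem G π) (hmaps : Set.MapsTo π (Set.range c) (Set.range c)) :
    ∃ f ∈ cycleTurns c, Set.EqOn π f (Set.range c) := by
  have hstep (i : Fin n) : π (c i) = c i ∨ π (c i) = c (finRotate n i) ∨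
      π (c i) = c ((finRotate n)⁻¹ i) := by
    obtain ⟨j, hj⟩ := hmaps ⟨i, rfl⟩
    refine or_iff_not_imp_left.2 fun hne => ?_
    have hadj := hc i j (hj ▸ hπ.movesAlongEdges _ hne)
    rw [← hj]
    exact (eq_finRotate_or_of_cycleGraph_adj hadj).imp (congrArg c) (congrArg c)
  by_cases hfix : ∀ i, π (c i) = c i
  · refine ⟨1, mem_cycleTurns.2 (.inl rfl), ?_⟩
    rintro _ ⟨i, rfl⟩
    exact hfix i
  · push Not at hfix
    obtain ⟨i, hi⟩ := hfix
    rcases (hstep i).resolve_left hi with h | h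
    · refine ⟨_, mem_cycleTurns.2 (.inr (.inl rfl)), ?_⟩
      rintro _ ⟨j, rfl⟩
      rw [copyRotation_apply]
      exact hπ.hasNoTwoCycles.apply_eq_rotation c.injective
        (finRotate_ne_self (Nat.le_of_succ_le hn)) sameCycle_finRotate hstep h j
    · refine ⟨_, mem_cycleTurns.2 (.inr (.inr rfl)), ?_⟩
      rintro _ ⟨j, rfl⟩
      rw [copyRotation_inv_apply]
      refine hπ.hasNoTwoCycles.apply_eq_rotation (ρ := (finRotate n)⁻¹) c.injective
        (fun j => ?_) (fun i j => (sameCycle_finRotate i j).inv) (fun i => ?_) h j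
      · rw [ne_eq, Perm.inv_eq_iff_eq]
        exact (finRotate_ne_self (Nat.le_of_succ_le hn) j).symm
      · rw [inv_inv]
        exact (hstep i).imp_right Or.symm

variable {m : ℕ} {c' : SimpleGraph.Copy (SimpleGraph.cycleGraph m) G}

theorem disjoint_of_mem_cycleTurns (hdisj : Disjoint (Set.range c) (Set.range c')) {f g : Perm V}
    (hf : f ∈ cycleTurns c) (hg : g ∈ cycleTurns c') : f.Disjoint g := fun _ =>
  or_iff_not_imp_left.2 fun hfv => apply_eq_self_of_mem_cycleTurns hg fun hv' =>
    hfv (apply_eq_self_of_mem_cycleTurns hf (hdisj.notMem_of_mem_right hv'))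

theorem injOn_mul_cycleTurns (hdisj : Disjoint (Set.range c) (Set.range c')) :
    Set.InjOn (fun fg : Perm V × Perm V => fg.1 * fg.2) ↑(cycleTurns c ×ˢ cycleTurns c') := by
  rintro ⟨f, g⟩ hfg ⟨f', g'⟩ hfg' (heq : f * g = f' * g')
  obtain ⟨hf, hg⟩ := Finset.mem_product.1 hfg
  obtain ⟨hf', hg'⟩ := Finset.mem_product.1 hfg'
  obtain rfl : f = f' := Equiv.ext fun v => by
    by_cases hv : v ∈ Set.range c
    · have hv' := hdisj.notMem_of_mem_left hv
      simpa only [Perm.mul_apply, apply_eq_self_of_mem_cycleTurns hg hv',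
        apply_eq_self_of_mem_cycleTurns hg' hv'] using Equiv.congr_fun heq v
    · rw [apply_eq_self_of_mem_cycleTurns hf hv, apply_eq_self_of_mem_cycleTurns hf' hv]
  rw [mul_left_cancel heq]

theorem IsCycleSystem.exists_mem_cycleTurns_mul_eq (hn : 3 ≤ n) (hm : 3 ≤ m)
    (hc : ∀ i j, G.Adj (c i) (c j) → (SimpleGraph.cycleGraph n).Adj i j)
    (hc' : ∀ i j, G.Adj (c' i) (c' j) → (SimpleGraph.cycleGraph m).Adj i j)
    (hdisj : Disjoint (Set.range c) (Set.range c')) {π : Perm V} (hπ : IsCycleSystem G π)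
    (hmaps : Set.MapsTo π (Set.range c) (Set.range c))
    (hmaps' : Set.MapsTo π (Set.range c') (Set.range c'))
    (hfix : ∀ v, v ∉ Set.range c → v ∉ Set.range c' → π v = v) :
    ∃ f ∈ cycleTurns c, ∃ g ∈ cycleTurns c', f * g = π := by
  obtain ⟨f, hf, hπf⟩ := hπ.exists_mem_cycleTurns_eqOn hn hc hmaps
  obtain ⟨g, hg, hπg⟩ := hπ.exists_mem_cycleTurns_eqOn hm hc' hmaps'
  refine ⟨f, hf, g, hg, Equiv.ext fun v => ?_⟩
  rw [Perm.mul_apply]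
  by_cases hv : v ∈ Set.range c
  · rw [apply_eq_self_of_mem_cycleTurns hg (hdisj.notMem_of_mem_left hv), hπf hv]
  by_cases hv' : v ∈ Set.range c'
  · rw [← hπg hv', apply_eq_self_of_mem_cycleTurns hf (hdisj.notMem_of_mem_right (hmaps' hv'))]
  · rw [apply_eq_self_of_mem_cycleTurns hg hv', apply_eq_self_of_mem_cycleTurns hf hv,
      hfix v hv hv']

end CopyRotation

namespace UnitGainGraph

variable {V : Type*} [Fintype V] [DecidableEq V] {G : SimpleGraph V} (Φ : UnitGainGraph G)
  {m n : ℕ} (hm : 3 ≤ m) (hn : 3 ≤ n)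

theorem permWeight_copyRotation (c : SimpleGraph.Copy (SimpleGraph.cycleGraph n) G) :
    Φ.permWeight (copyRotation c) = -Φ.cycleGain hn c := by
  have hsupp : (copyRotation c).support = Finset.univ.map c.toEmbedding := by
    ext v
    rw [Perm.mem_support, copyRotation_apply_ne_iff c (Nat.le_of_succ_le hn), ← Finset.mem_coe,
      Finset.coe_map, Finset.coe_univ, Set.image_univ]
    rfl
  have hsign : ((Perm.sign (copyRotation c) : ℤ) : ℂ) = (-1) ^ (n - 1) := by
    rw [copyRotation, Perm.viaFintypeEmbedding_sign, sign_finRotate]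
    push_cast
    rfl
  have hprod : ∏ i, Φ.adjMatrix (c i) (copyRotation c (c i)) = Φ.cycleGain hn c := by
    refine Eq.trans (Finset.prod_congr rfl fun i _ => ?_) (map_prod Circle.coeHom _ _).symm
    rw [copyRotation_apply]
    exact Φ.adjMatrix_apply_of_adj _
  calc Φ.permWeight (copyRotation c)
      = (-1) ^ (n - 1) * ∏ i, -Φ.adjMatrix (c i) (copyRotation c (c i)) := by
        rw [permWeight, hsign, hsupp, Finset.prod_map]
        rfl
    _ = (-1) ^ (n - 1 + n) * Φ.cycleGain hn c := by
        rw [Finset.prod_neg, hprod, Finset.card_univ, Fintype.card_fin, ← mul_assoc, ← pow_add]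
    _ = -Φ.cycleGain hn c := by
        rw [Odd.neg_one_pow ⟨n - 1, by omega⟩, neg_one_mul]

theorem sum_permWeight_cycleTurns (c : SimpleGraph.Copy (SimpleGraph.cycleGraph n) G)
    (F : Set V → ℂ[X]) :
    ∑ f ∈ cycleTurns c, C (Φ.permWeight f) * F (Function.fixedPoints f) =
      F Set.univ - C (2 * ((Φ.cycleGain hn c : ℂ).re : ℂ)) * F (Set.range c)ᶜ := by
  have hone : Function.fixedPoints (1 : Perm V) = Set.univ := Set.eq_univ_of_forall fun _ => rfl
  have hrot := fixedPoints_copyRotation c (Nat.le_of_succ_le hn)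
  have hinv : Function.fixedPoints ⇑(copyRotation c)⁻¹ = (Set.range c)ᶜ := by
    rw [← hrot]
    exact Set.ext fun v => Perm.inv_eq_iff_eq.trans eq_comm
  have hne : (1 : Perm V) ∉ ({copyRotation c, (copyRotation c)⁻¹} : Finset (Perm V)) := by
    rw [Finset.mem_insert, Finset.mem_singleton, eq_comm, one_eq_inv, or_self]
    exact copyRotation_ne_one (Nat.le_of_succ_le hn)
  rw [cycleTurns, Finset.sum_insert hne, Finset.sum_pair (copyRotation_ne_inv hn), permWeight_one,
    permWeight_inv, Φ.permWeight_copyRotation hn, hone, hinv, hrot, ← add_mul, ← C_add,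
    Complex.add_conj, C_1, one_mul, Complex.neg_re]
  push_cast
  rw [mul_neg, C_neg, neg_mul, sub_eq_add_neg]

variable {c : SimpleGraph.Copy (SimpleGraph.cycleGraph m) G}
  {c' : SimpleGraph.Copy (SimpleGraph.cycleGraph n) G}

theorem sum_permWeight_cycleTurns_inter (F : Set V → ℂ[X]) :
    ∑ f ∈ cycleTurns c, C (Φ.permWeight f) * ∑ g ∈ cycleTurns c',
        C (Φ.permWeight g) * F (Function.fixedPoints f ∩ Function.fixedPoints g) =
      F Set.univ
        - C (2 * ((Φ.cycleGain hm c : ℂ).re : ℂ)) * F (Set.range c)ᶜ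
        - C (2 * ((Φ.cycleGain hn c' : ℂ).re : ℂ)) * F (Set.range c')ᶜ
        + C (4 * ((Φ.cycleGain hm c : ℂ).re : ℂ) * ((Φ.cycleGain hn c' : ℂ).re : ℂ)) *
            F (Set.range c ∪ Set.range c')ᶜ := by
  have hinner (f : Perm V) :=
    Φ.sum_permWeight_cycleTurns hn c' fun S => F (Function.fixedPoints f ∩ S)
  simp only [hinner]
  rw [Φ.sum_permWeight_cycleTurns hm c fun S => F (S ∩ Set.univ) -
      C (2 * ((Φ.cycleGain hn c' : ℂ).re : ℂ)) * F (S ∩ (Set.range c')ᶜ), Set.compl_union]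
  simp only [Set.inter_univ, Set.univ_inter, C_mul, C_ofNat]
  ring

include hm hn in
theorem charPoly_eq_sum_cycleTurns (hdisj : Disjoint (Set.range c) (Set.range c'))
    (hturns : ∀ π, IsCycleSystem G π → ∃ f ∈ cycleTurns c, ∃ g ∈ cycleTurns c', f * g = π) :
    Φ.charPoly = ∑ f ∈ cycleTurns c, C (Φ.permWeight f) * ∑ g ∈ cycleTurns c',
      C (Φ.permWeight g) *
        matchingPoly (G.induce (Function.fixedPoints f ∩ Function.fixedPoints g)) := by
  classical
  have hfg {fg : Perm V × Perm V} (h : fg ∈ cycleTurns c ×ˢ cycleTurns c') :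
      fg.1.Disjoint fg.2 :=
    disjoint_of_mem_cycleTurns hdisj (Finset.mem_product.1 h).1 (Finset.mem_product.1 h).2
  simp only [Finset.mul_sum]
  rw [Φ.charPoly_eq_sum_isCycleSystem, ← Finset.sum_product']
  symm
  refine Finset.sum_bij (fun fg _ => fg.1 * fg.2) (fun fg h => ?_) (fun fg h fg' h' heq => ?_)
    (fun π hπ => ?_) fun fg h => ?_
  · obtain ⟨hf, hg⟩ := Finset.mem_product.1 h
    exact Finset.mem_filter.2 ⟨Finset.mem_univ _,
      (isCycleSystem_of_mem_cycleTurns hm hf).mul_of_disjoint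
        (isCycleSystem_of_mem_cycleTurns hn hg) (hfg h)⟩
  · exact injOn_mul_cycleTurns hdisj h h' heq
  · obtain ⟨f, hf, g, hg, rfl⟩ := hturns π (Finset.mem_filter.1 hπ).2
    exact ⟨(f, g), Finset.mem_product.2 ⟨hf, hg⟩, rfl⟩
  · have hfix : Function.fixedPoints ⇑(fg.1 * fg.2) =
        Function.fixedPoints fg.1 ∩ Function.fixedPoints fg.2 :=
      Set.ext fun _ => (hfg h).mul_apply_eq_iff
    rw [Φ.permWeight_mul_of_disjoint (hfg h), hfix, C_mul, mul_assoc]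

theorem charPoly_eq_of_two_cycles (hdisj : Disjoint (Set.range c) (Set.range c'))
    (hturns : ∀ π, IsCycleSystem G π → ∃ f ∈ cycleTurns c, ∃ g ∈ cycleTurns c', f * g = π) :
    Φ.charPoly = matchingPoly G
      - C (2 * ((Φ.cycleGain hm c : ℂ).re : ℂ)) * matchingPoly (deleteCopy G c)
      - C (2 * ((Φ.cycleGain hn c' : ℂ).re : ℂ)) * matchingPoly (deleteCopy G c')
      + C (4 * ((Φ.cycleGain hm c : ℂ).re : ℂ) * ((Φ.cycleGain hn c' : ℂ).re : ℂ)) *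
          matchingPoly (G.induce (Set.range c ∪ Set.range c')ᶜ) := by
  rw [Φ.charPoly_eq_sum_cycleTurns hm hn hdisj hturns]
  have hsum := Φ.sum_permWeight_cycleTurns_inter hm hn (c := c) (c' := c')
    fun S => matchingPoly (G.induce S)
  rwa [matchingPoly_eq_of_iso (SimpleGraph.induceUnivIso G)] at hsum

end UnitGainGraph

/- A permutation of a finite set that leaves `S` also enters `S`. With only one edge available for
both crossings, it exchanges the two ends of that edge. -/
theorem IsCycleSystem.mapsTo_of_unique_adj {V : Type*} [Finite V] {G : SimpleGraph V} {π : Perm V}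
    (hπ : IsCycleSystem G π) {S : Set V}
    (hS : ∀ ⦃u⦄, u ∈ S → ∀ ⦃v⦄, v ∉ S → ∀ ⦃u'⦄, u' ∈ S → ∀ ⦃v'⦄, v' ∉ S →
      G.Adj u v → G.Adj u' v' → u = u' ∧ v = v') :
    Set.MapsTo π S S := by
  intro u hu
  by_contra hπu
  obtain ⟨v, hv, hπv⟩ : ∃ v ∉ S, π v ∈ S := by
    by_contra! hmaps
    exact π.perm_symm_mapsTo_of_mapsTo (s := Sᶜ) hmaps hπu (by rwa [Equiv.symm_apply_apply])
  have hadj_u : G.Adj u (π u) := hπ.movesAlongEdges u fun h => hπu (by rwa [h])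
  have hne : π v ≠ v := fun h => hv (by rwa [← h])
  obtain ⟨rfl, hvv⟩ := hS hu hπu hπv hv hadj_u (hπ.movesAlongEdges v hne).symm
  exact hne (hπ.hasNoTwoCycles v hvv)

section Dumbbell

variable {r s ℓ : ℕ} {p : Fin r} {q : Fin s}

/-- The number of edges of the connecting path that lie between `C_r` and the given vertex: zero on
`C_r`, and `ℓ` on `C_s`. -/
def dumbbellHeight : DumbbellVertex r s ℓ → ℕ
  | .inl _ => 0
  | .inr (.inl _) => ℓ
  | .inr (.inr k) => k + 1

/-- The vertex at height `k` on the connecting path, `p` and `q` included; equal to `q` beyond the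
end of the path. -/
def dumbbellPathVertex (p : Fin r) (q : Fin s) (k : ℕ) : DumbbellVertex r s ℓ :=
  if h : k = 0 then .inl p else if h' : k < ℓ then .inr (.inr ⟨k - 1, by omega⟩) else .inr (.inl q)

theorem dumbbell_adj_of_dumbbellHeight_lt {u v : DumbbellVertex r s ℓ}
    (hadj : (dumbbell r s ℓ p q).Adj u v) (hlt : dumbbellHeight u < dumbbellHeight v) :
    dumbbellHeight v = dumbbellHeight u + 1 ∧ u = dumbbellPathVertex p q (dumbbellHeight u) ∧
      v = dumbbellPathVertex p q (dumbbellHeight v) := by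
  change dumbbellAdj p q u v at hadj
  rcases u with i | j | ⟨k, hk⟩ <;> rcases v with i' | j' | ⟨k', hk'⟩ <;>
    simp only [dumbbellHeight, dumbbellAdj, SimpleGraph.pathGraph_adj] at hadj hlt ⊢ <;>
    grind [dumbbellPathVertex]

theorem IsCycleSystem.dumbbellHeight_apply_le {π : Perm (DumbbellVertex r s ℓ)}
    (hπ : IsCycleSystem (dumbbell r s ℓ p q) π) (v : DumbbellVertex r s ℓ) :
    dumbbellHeight (π v) ≤ dumbbellHeight v := by
  refine hπ.mapsTo_of_unique_adj (S := {u | dumbbellHeight u ≤ dumbbellHeight v}) ?_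
    (Set.mem_ofPred.2 le_rfl)
  intro a ha b hb a' ha' b' hb' hab hab'
  simp only [Set.mem_ofPred_eq, not_le] at ha hb ha' hb'
  obtain ⟨hh, hpa, hpb⟩ := dumbbell_adj_of_dumbbellHeight_lt hab (ha.trans_lt hb)
  obtain ⟨hh', hpa', hpb'⟩ := dumbbell_adj_of_dumbbellHeight_lt hab' (ha'.trans_lt hb')
  rw [hpa, hpb, hpa', hpb', show dumbbellHeight a = dumbbellHeight a' by omega,
    show dumbbellHeight b = dumbbellHeight b' by omega]
  exact ⟨rfl, rfl⟩

theorem IsCycleSystem.dumbbellHeight_apply {π : Perm (DumbbellVertex r s ℓ)}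
    (hπ : IsCycleSystem (dumbbell r s ℓ p q) π) (v : DumbbellVertex r s ℓ) :
    dumbbellHeight (π v) = dumbbellHeight v :=
  le_antisymm (hπ.dumbbellHeight_apply_le v)
    (by simpa only [Perm.inv_def, Equiv.symm_apply_apply]
      using hπ.inv.dumbbellHeight_apply_le (π v))

theorem disjoint_range_dumbbellCycles : Disjoint (Set.range (dumbbellCycleLeft r s ℓ p q))
    (Set.range (dumbbellCycleRight r s ℓ p q)) := by
  rw [Set.disjoint_left]
  rintro _ ⟨i, rfl⟩ ⟨j, hj⟩
  exact Sum.inr_ne_inl hj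

theorem mem_range_dumbbellCycleLeft_iff (hℓ : 1 ≤ ℓ) {v : DumbbellVertex r s ℓ} :
    v ∈ Set.range (dumbbellCycleLeft r s ℓ p q) ↔ dumbbellHeight v = 0 := by
  rcases v with i | j | k
  · exact iff_of_true ⟨i, rfl⟩ rfl
  · exact iff_of_false (fun ⟨_, h⟩ => Sum.inl_ne_inr h) (Nat.ne_of_gt hℓ)
  · exact iff_of_false (fun ⟨_, h⟩ => Sum.inl_ne_inr h) (Nat.succ_ne_zero k)

theorem mem_range_dumbbellCycleRight_iff (hℓ : 1 ≤ ℓ) {v : DumbbellVertex r s ℓ} :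
    v ∈ Set.range (dumbbellCycleRight r s ℓ p q) ↔ dumbbellHeight v = ℓ := by
  rcases v with i | j | k
  · exact iff_of_false (fun ⟨_, h⟩ => Sum.inr_ne_inl h) (Nat.ne_of_lt hℓ)
  · exact iff_of_true ⟨j, rfl⟩ rfl
  · refine iff_of_false (fun ⟨_, h⟩ => Sum.inl_ne_inr (Sum.inr_injective h)) ?_
    rw [dumbbellHeight]
    omega

theorem eq_of_dumbbellHeight_eq {k : Fin (ℓ - 1)} {v : DumbbellVertex r s ℓ}
    (h : dumbbellHeight v = k + 1) : v = .inr (.inr k) := by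
  rcases v with i | j | k' <;> simp only [dumbbellHeight] at h
  · omega
  · omega
  · obtain rfl : k' = k := by omega
    rfl

theorem IsCycleSystem.exists_dumbbell_cycleTurns (hr : 3 ≤ r) (hs : 3 ≤ s) (hℓ : 1 ≤ ℓ)
    {π : Perm (DumbbellVertex r s ℓ)} (hπ : IsCycleSystem (dumbbell r s ℓ p q) π) :
    ∃ f ∈ cycleTurns (dumbbellCycleLeft r s ℓ p q),
      ∃ g ∈ cycleTurns (dumbbellCycleRight r s ℓ p q), f * g = π := by
  refine hπ.exists_mem_cycleTurns_mul_eq hr hs (fun _ _ h => h) (fun _ _ h => h)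
    disjoint_range_dumbbellCycles (fun v hv => ?_) (fun v hv => ?_) fun v hv hv' => ?_
  · rwa [mem_range_dumbbellCycleLeft_iff hℓ, hπ.dumbbellHeight_apply,
      ← mem_range_dumbbellCycleLeft_iff hℓ]
  · rwa [mem_range_dumbbellCycleRight_iff hℓ, hπ.dumbbellHeight_apply,
      ← mem_range_dumbbellCycleRight_iff hℓ]
  · rcases v with i | j | k
    · exact absurd ⟨i, rfl⟩ hv
    · exact absurd ⟨j, rfl⟩ hv'
    · exact eq_of_dumbbellHeight_eq (hπ.dumbbellHeight_apply _)

/-- Deleting both cycles from the dumbbell graph leaves the interior of the connecting path. -/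
noncomputable def pathGraphIsoDumbbellInterior (p : Fin r) (q : Fin s) :
    SimpleGraph.pathGraph (ℓ - 1) ≃g (dumbbell r s ℓ p q).induce
      (Set.range (dumbbellCycleLeft r s ℓ p q) ∪ Set.range (dumbbellCycleRight r s ℓ p q))ᶜ where
  toEquiv := Equiv.ofBijective (fun k => ⟨.inr (.inr k), by
    rintro (⟨i, hi⟩ | ⟨j, hj⟩)
    · exact Sum.inl_ne_inr hi
    · exact Sum.inl_ne_inr (Sum.inr_injective hj)⟩) <| by
    refine ⟨fun k k' h => Sum.inr_injective (Sum.inr_injective (congrArg Subtype.val h)), ?_⟩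
    rintro ⟨i | j | k, hv⟩
    · exact absurd (.inl ⟨i, rfl⟩) hv
    · exact absurd (.inr ⟨j, rfl⟩) hv
    · exact ⟨k, rfl⟩
  map_rel_iff' := Iff.rfl

end Dumbbell

theorem mainTheorem1 (r s ℓ : ℕ) (hr : 3 ≤ r) (hs : 3 ≤ s) (hℓ : 1 ≤ ℓ)
    (p : Fin r) (q : Fin s) (Φ : UnitGainGraph (dumbbell r s ℓ p q)) (a b : ℝ)
    (ha : a = (Φ.cycleGain hr (dumbbellCycleLeft r s ℓ p q) : ℂ).re)
    (hb : b = (Φ.cycleGain hs (dumbbellCycleRight r s ℓ p q) : ℂ).re) :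
    Φ.charPoly =
      matchingPoly (dumbbell r s ℓ p q)
        - C (2 * (a : ℂ)) *
            matchingPoly (deleteCopy (dumbbell r s ℓ p q) (dumbbellCycleLeft r s ℓ p q))
        - C (2 * (b : ℂ)) *
            matchingPoly (deleteCopy (dumbbell r s ℓ p q) (dumbbellCycleRight r s ℓ p q))
        + C (4 * (a : ℂ) * (b : ℂ)) * matchingPoly (SimpleGraph.pathGraph (ℓ - 1)) := by
  rw [Φ.charPoly_eq_of_two_cycles hr hs disjoint_range_dumbbellCycles
    fun π hπ => hπ.exists_dumbbell_cycleTurns hr hs hℓ, ha, hb,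
    matchingPoly_eq_of_iso (pathGraphIsoDumbbellInterior p q)]
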